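/- **Bosonic birthday paradox for the product circuit ensemble.** Let $M, N$ be integers with $N \ge 1$ and $M \ge 2N^2$. A configuration of $N$ photons over $M$ modes is a vector $\boldsymbol{s} = (s_1,\dots,s_M)$ of non-negative integers with $\sum_{i=1}^M s_i = N$. It is collision-free if every $s_i \in \{0,1\}$. Let $B_{M,N}$ be the set of all other (collision) configurations. Fix a collision-free input configuration $\boldsymbol{t}$. For a unitary matrix $U \in \mathrm{U}(M)$, let $\mathcal{D}_U$ be the Boson Sampling output distribution on configurations, which gives the outcome $\boldsymbol{s}$ the probability $$p_{\boldsymbol{s}}(U) = \frac{1}{\prod_{i=1}^M s_i!}\,\bigl|\mathrm{Per}(U_{\boldsymbol{s},\boldsymbol{t}})\bigr|^2,$$ where $U_{\boldsymbol{s},\boldsymbol{t}}$ is the $N\times N$ matrix obtained by taking $s_i$ copies of the $i$th row and $t_j$ copies of the $j$th column of $U$. Let $\mathcal{A}$ be any linear optical circuit architecture on $M$ modes, that is, a finite sequence of single-mode and two-mode gates with fixed types and locations and unspecified coefficients in $\mathrm{U}(1)$ or $\mathrm{U}(2)$. Let $\mathcal{H}_{\mathcal{A}}$ be the distribution of the circuit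 (the product of its gates in $\mathrm{U}(M)$) when the gates are independent and Haar distributed, let $\mathcal{P}$ be the uniform distribution over all $M\times M$ permutation matrices, and let $\mathcal{H}_{\mathcal{A}}\mathcal{P}$ be the distribution of $HP$ for independent $H\sim\mathcal{H}_{\mathcal{A}}$ and $P\sim\mathcal{P}$ (the permutation acts first on the input). Then $U \mapsto \Pr_{\boldsymbol{s}\sim\mathcal{D}_U}[\boldsymbol{s}\in B_{M,N}]$ is integrable and $$\mathbb{E}_{U\sim\mathcal{H}_{\mathcal{A}}\mathcal{P}}\Bigl[\Pr_{\boldsymbol{s}\sim\mathcal{D}_U}[\boldsymbol{s}\in B_{M,N}]\Bigr] < \frac{2N^2}{M}.$$ -/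

import Mathlib

open MeasureTheory

noncomputable section

namespace BosonSampling

/-! ## Linear optical circuits as unitary matrices -/

/-- The unitary group `U(k)`: the linear optical circuits on `k` modes. -/
abbrev U (k : ℕ) : Type := Matrix.unitaryGroup (Fin k) ℂ

instance (k : ℕ) : MeasurableSpace (U k) := borel _

instance (k : ℕ) : BorelSpace (U k) := ⟨rfl⟩

instance (k : ℕ) : SecondCountableTopology (U k) :=
  haveI : SecondCountableTopology (Matrix (Fin k) (Fin k) ℂ) :=
    inferInstanceAs (SecondCountableTopology (Fin k → Fin k → ℂ))
  TopologicalSpace.Subtype.secondCountableTopology _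

instance (k : ℕ) : CompactSpace (U k) := by
  apply isCompact_iff_compactSpace.mp
  have hK : IsCompact (Set.pi Set.univ fun _ : Fin k =>
      Set.pi Set.univ fun _ : Fin k => Metric.closedBall (0 : ℂ) 1) :=
    isCompact_univ_pi fun _ => isCompact_univ_pi fun _ => isCompact_closedBall 0 1
  refine IsCompact.of_isClosed_subset (X := Matrix (Fin k) (Fin k) ℂ) hK ?_ ?_
  · have h : ((Matrix.unitaryGroup (Fin k) ℂ : Submonoid (Matrix (Fin k) (Fin k) ℂ)) :
        Set (Matrix (Fin k) (Fin k) ℂ)) = {A | A * star A = 1} := by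
      ext A
      exact Matrix.mem_unitaryGroup_iff
    rw [h]
    exact isClosed_eq (continuous_id.mul continuous_star) continuous_const
  · intro A hA i _ j _
    simpa using entry_norm_bound_of_unitary hA i j

/-- The Haar probability measure on `U(k)`. -/
def haar (k : ℕ) : Measure (U k) :=
  Measure.haarMeasure (⊤ : TopologicalSpace.PositiveCompacts (U k))

instance (k : ℕ) : IsProbabilityMeasure (haar k) :=
  ⟨by simpa [haar] using
    Measure.haarMeasure_self (K₀ := (⊤ : TopologicalSpace.PositiveCompacts (U k)))⟩

/-! ## Circuit architectures -/

/-- The type and location of a gate among `M` modes: it is a single-mode or a two-mode gate, and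
`modes` lists the (distinct) modes on which it acts. -/
structure Gate (M : ℕ) where
  /-- the number of modes on which the gate acts -/
  arity : ℕ
  arity_eq : arity = 1 ∨ arity = 2
  /-- the modes on which the gate acts -/
  modes : Fin arity ↪ Fin M

/-- A linear optical circuit architecture on `M` modes: the sequence of its gates, in the order in
which they are applied, with coefficients left open. (Gates applied in parallel act on disjoint
modes, hence commute, and may be listed in any order.) -/
abbrev Architecture (M : ℕ) : Type := List (Gate M)

/-- The `0`-`1` matrix whose column `a` is the standard basis vector of the mode `e a`. -/
def inclusionMatrix {k M : ℕ} (e : Fin k ↪ Fin M) : Matrix (Fin M) (Fin k) ℂ :=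
  Matrix.of fun i a => if i = e a then 1 else 0

/-- The `M × M` matrix of a gate with coefficients `V` on the modes `e 0, e 1, …`: it acts as `V` on
these modes and trivially on the other ones (see the three lemmas that follow). -/
def gateMatrix {k M : ℕ} (e : Fin k ↪ Fin M) (V : Matrix (Fin k) (Fin k) ℂ) :
    Matrix (Fin M) (Fin M) ℂ :=
  1 + inclusionMatrix e * (V - 1) * (inclusionMatrix e).conjTranspose

theorem gateMatrix_apply_modes {k M : ℕ} (e : Fin k ↪ Fin M) (V : Matrix (Fin k) (Fin k) ℂ)
    (a b : Fin k) : gateMatrix e V (e a) (e b) = V a b := by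
  simp [gateMatrix, inclusionMatrix, Matrix.mul_apply, Matrix.one_apply]

theorem gateMatrix_apply_left {k M : ℕ} (e : Fin k ↪ Fin M) (V : Matrix (Fin k) (Fin k) ℂ)
    (i j : Fin M) (hi : ∀ a, i ≠ e a) : gateMatrix e V i j = if i = j then 1 else 0 := by
  simp [gateMatrix, inclusionMatrix, Matrix.mul_apply, Matrix.one_apply, hi]

theorem gateMatrix_apply_right {k M : ℕ} (e : Fin k ↪ Fin M) (V : Matrix (Fin k) (Fin k) ℂ)
    (i j : Fin M) (hj : ∀ a, j ≠ e a) : gateMatrix e V i j = if i = j then 1 else 0 := by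
  simp [gateMatrix, inclusionMatrix, Matrix.mul_apply, Matrix.one_apply, hj]

theorem inclusionMatrix_isometry {k M : ℕ} (e : Fin k ↪ Fin M) :
    (inclusionMatrix e).conjTranspose * inclusionMatrix e = 1 := by
  ext a b
  simp [inclusionMatrix, Matrix.mul_apply, Matrix.one_apply, eq_comm]

theorem gateMatrix_mem {k M : ℕ} (e : Fin k ↪ Fin M) (V : U k) :
    gateMatrix e (V : Matrix (Fin k) (Fin k) ℂ) ∈ Matrix.unitaryGroup (Fin M) ℂ := by
  rw [Matrix.mem_unitaryGroup_iff]
  have hV : (V : Matrix (Fin k) (Fin k) ℂ) * (V : Matrix (Fin k) (Fin k) ℂ).conjTranspose = 1 :=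
    Matrix.mem_unitaryGroup_iff.mp V.2
  have hE := inclusionMatrix_isometry e
  generalize (V : Matrix (Fin k) (Fin k) ℂ) = W at hV
  simp only [gateMatrix, Matrix.star_eq_conjTranspose]
  generalize inclusionMatrix e = E at hE
  have h1 : (1 + E * (W - 1) * E.conjTranspose).conjTranspose
      = 1 + E * (W.conjTranspose - 1) * E.conjTranspose := by
    simp [Matrix.conjTranspose_mul, Matrix.mul_assoc]
  rw [h1]
  have h2 : (E * (W - 1) * E.conjTranspose) * (E * (W.conjTranspose - 1) * E.conjTranspose)
      = E * ((W - 1) * (W.conjTranspose - 1)) * E.conjTranspose := by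
    calc _ = E * (W - 1) * (E.conjTranspose * E) * (W.conjTranspose - 1) * E.conjTranspose := by
          simp only [Matrix.mul_assoc]
      _ = _ := by rw [hE]; simp only [Matrix.mul_assoc, Matrix.one_mul]
  have h3 : (W - 1) * (W.conjTranspose - 1) = -(W - 1) - (W.conjTranspose - 1) := by
    rw [sub_mul, mul_sub, hV]; simp only [Matrix.mul_one, Matrix.one_mul]; abel
  rw [add_mul, mul_add, mul_add, h2, h3]
  simp only [Matrix.mul_sub, Matrix.sub_mul, Matrix.mul_one, Matrix.one_mul, Matrix.mul_neg,
    Matrix.neg_mul]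
  abel

/-- The `M`-mode circuit that consists of one gate with coefficients `V`. -/
def gateUnitary {k M : ℕ} (e : Fin k ↪ Fin M) (V : U k) : U M :=
  ⟨gateMatrix e V, gateMatrix_mem e V⟩

/-- A choice of the coefficients of all gates of an architecture. -/
abbrev Coefficients {M : ℕ} (A : Architecture M) : Type :=
  (g : Fin A.length) → U (A.get g).arity

/-- The circuit with architecture `A` and gate coefficients `V`: the product of its gates, where
gates that are applied earlier stand further to the right. -/
def circuit {M : ℕ} (A : Architecture M) (V : Coefficients A) : U M :=
  ((List.ofFn fun g => gateUnitary (A.get g).modes (V g)).reverse).prod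

/-! ## Random circuits -/

/-- The local random circuit ensemble over the architecture `A`: the law of the circuit whose gate
coefficients are independent and Haar distributed. -/
def localRandomEnsemble {M : ℕ} (A : Architecture M) : Measure (U M) :=
  Measure.map (circuit A) (Measure.pi fun g : Fin A.length => haar (A.get g).arity)

theorem permMatrix_mem {M : ℕ} (σ : Equiv.Perm (Fin M)) :
    σ.permMatrix ℂ ∈ Matrix.unitaryGroup (Fin M) ℂ := by
  rw [Matrix.mem_unitaryGroup_iff, Matrix.star_eq_conjTranspose, Matrix.conjTranspose_permMatrix,
    ← Matrix.permMatrix_mul]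
  simp

/-- The permutation circuit of `σ`. -/
def permUnitary {M : ℕ} (σ : Equiv.Perm (Fin M)) : U M :=
  ⟨σ.permMatrix ℂ, permMatrix_mem σ⟩

/-- The random permutation circuit ensemble: the law of a uniformly random `M × M` permutation
matrix. -/
def permutationEnsemble (M : ℕ) : Measure (U M) :=
  ((PMF.uniformOfFintype (Equiv.Perm (Fin M))).map permUnitary).toMeasure

/-- The product circuit ensemble: the law of `H * P` for independent `H` and `P`, drawn from the
local random circuit ensemble over `A` and the random permutation circuit ensemble. The permutation
circuit acts first on the input. -/
def productEnsemble {M : ℕ} (A : Architecture M) : Measure (U M) :=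
  Measure.map (fun x : U M × U M => x.1 * x.2)
    ((localRandomEnsemble A).prod (permutationEnsemble M))

theorem continuous_circuit {M : ℕ} (A : Architecture M) : Continuous (circuit A) := by
  have hg : ∀ g : Fin A.length,
      Continuous fun V : Coefficients A => gateUnitary (A.get g).modes (V g) := by
    intro g
    refine Continuous.subtype_mk ?_ _
    have hv : Continuous fun V : Coefficients A =>
        ((V g : U (A.get g).arity) : Matrix (Fin (A.get g).arity) (Fin (A.get g).arity) ℂ) :=
      continuous_subtype_val.comp (continuous_apply g)
    unfold gateMatrix
    exact continuous_const.add
      ((continuous_const.matrix_mul (hv.sub continuous_const)).matrix_mul continuous_const)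
  have h : (circuit A) = fun V : Coefficients A =>
      (((List.finRange A.length).reverse).map fun g =>
        gateUnitary (A.get g).modes (V g)).prod := by
    funext V
    rw [circuit, List.ofFn_eq_map, List.map_reverse]
  rw [h]
  exact continuous_list_prod _ fun g _ => hg g

instance {M : ℕ} (A : Architecture M) : IsProbabilityMeasure (localRandomEnsemble A) :=
  Measure.isProbabilityMeasure_map (continuous_circuit A).measurable.aemeasurable

instance (M : ℕ) : IsProbabilityMeasure (permutationEnsemble M) :=
  PMF.toMeasure.isProbabilityMeasure _

instance {M : ℕ} (A : Architecture M) : IsProbabilityMeasure (productEnsemble A) :=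
  Measure.isProbabilityMeasure_map
    (continuous_fst.mul continuous_snd).measurable.aemeasurable

/-! ## Output probabilities -/

/-- The configurations of `N` photons over `M` modes: `s i` is the number of photons in the
mode `i`. -/
abbrev Configuration (M N : ℕ) : Type := {s : Fin M → ℕ // ∑ i, s i = N}

instance (M N : ℕ) : Fintype (Configuration M N) :=
  Fintype.subtype (Finset.Nat.antidiagonalTuple M N) fun _ => Finset.Nat.mem_antidiagonalTuple

/-- No mode holds more than one photon. -/
def CollisionFree {M N : ℕ} (s : Configuration M N) : Prop := ∀ i, s.1 i ≤ 1

/-- The set of collision configurations. -/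
def collisionOutcomes (M N : ℕ) : Set (Configuration M N) := {s | ¬ CollisionFree s}

/-- The modes of the `N` photons of `s`, in increasing order: the mode `i` occurs `s i` times. -/
def photonMode {M N : ℕ} (s : Configuration M N) (k : Fin N) : Fin M :=
  (finSigmaFinEquiv.symm (Fin.cast s.2.symm k)).1

/-- The `N × N` matrix that consists of `s i` copies of the row `i` and `t j` copies of the
column `j` of `C`. -/
def photonMatrix {M N : ℕ} (C : U M) (s t : Configuration M N) : Matrix (Fin N) (Fin N) ℂ :=
  (C : Matrix (Fin M) (Fin M) ℂ).submatrix (photonMode s) (photonMode t)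

/-- The output probability of the outcome `s` for the circuit `C` and the collision-free input
configuration `t`. -/
def outputProbability {M N : ℕ} (t : Configuration M N) (C : U M) (s : Configuration M N) : ℝ :=
  1 / (∏ i, (s.1 i).factorial : ℝ) * ‖(photonMatrix C s t).permanent‖ ^ 2

open Classical in
/-- The probability that the outcome lies in `S`, under the output distribution of the circuit `C`
with the input configuration `t`. -/
def outcomeProbability {M N : ℕ} (t : Configuration M N) (C : U M)
    (S : Set (Configuration M N)) : ℝ :=
  ∑ s with s ∈ S, outputProbability t C s

end BosonSampling

end

namespace BosonSampling

/-! The random permutation alone gives the bound, uniformly in the circuit `H` that follows it. For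
fixed `H` and outcome `s`, permuting the input replaces the columns of `t` by a uniformly random
injective choice of `N` columns. Each such choice comes from `(M - N)!` permutations, and the terms
are nonnegative, so the sum over injective choices is at most the sum over all maps `f`. That full
sum is computed from orthonormality of rows alone: it equals `N! ∏ sᵢ!`, and the factor `∏ sᵢ!`
cancels the normalisation of the output probability.

Hence every outcome has average probability at most `(M - N)! N! / M! = 1 / C(M, N)`. There are at
most `C(M + N - 1, N) - C(M, N)` collision outcomes, so it remains to show `C(M + N - 1, N) / C(M,
N) < 1 + 2N² / M`, which `choose_multiset_lt` does. -/

/-! ### Second moment of permanents over all column choices -/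

theorem sum_norm_sq_permanent_submatrix {M N : ℕ} (C : U M) (m : Fin N → Fin M) :
    ∑ f : Fin N → Fin M,
        ‖((C : Matrix (Fin M) (Fin M) ℂ).submatrix m f).permanent‖ ^ 2
      = N.factorial * ∏ i, ((Fintype.card {k // m k = i}).factorial : ℝ) := by
  classical
  have hC : ∀ a b, ∑ j, C.1 a j * starRingEnd ℂ (C.1 b j) = if a = b then 1 else 0 := by
    intro a b
    have h := congrFun (congrFun (Matrix.mem_unitaryGroup_iff.mp C.2) a) b
    simpa [Matrix.mul_apply, Matrix.star_apply, Matrix.one_apply] using h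
  have hcount : ∀ τ : Equiv.Perm (Fin N),
      ∑ σ : Equiv.Perm (Fin N), (if m ∘ σ = m ∘ τ then (1 : ℂ) else 0)
        = ∏ i, ((Fintype.card {k // m k = i}).factorial : ℂ) := by
    intro τ
    have hcard := DomMulAct.stabilizer_card m
    -- Right translation by `τ` reduces the count to the stabilizer of `m`, a product of symmetric
    -- groups of its fibres.
    rw [← Equiv.sum_comp (Equiv.mulRight τ)]
    have h : ∀ σ : Equiv.Perm (Fin N), m ∘ (Equiv.mulRight τ σ) = m ∘ τ ↔ m ∘ σ = m := by
      intro σ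
      constructor
      · intro h
        funext k
        simpa using congrFun h (τ.symm k)
      · intro h
        funext k
        simpa using congrFun h (τ k)
    simp only [h]
    rw [Finset.sum_boole, ← Fintype.card_subtype]
    exact_mod_cast congrArg (Nat.cast : ℕ → ℂ) hcard
  have key : ∑ f : Fin N → Fin M,
      ((‖((C : Matrix (Fin M) (Fin M) ℂ).submatrix m f).permanent‖ : ℂ)) ^ 2
      = N.factorial * ∏ i, ((Fintype.card {k // m k = i}).factorial : ℂ) := by
    calc _ = ∑ f : Fin N → Fin M, ∑ τ : Equiv.Perm (Fin N), ∑ σ : Equiv.Perm (Fin N),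
          ∏ i, (C.1 (m (σ i)) (f i) * starRingEnd ℂ (C.1 (m (τ i)) (f i))) := by
          refine Finset.sum_congr rfl fun f _ => ?_
          rw [← Complex.mul_conj', Matrix.permanent, map_sum, Finset.sum_mul_sum,
            Finset.sum_comm]
          simp [Finset.prod_mul_distrib]
      _ = ∑ τ : Equiv.Perm (Fin N), ∑ σ : Equiv.Perm (Fin N), ∑ f : Fin N → Fin M,
          ∏ i, (C.1 (m (σ i)) (f i) * starRingEnd ℂ (C.1 (m (τ i)) (f i))) := by
          rw [Finset.sum_comm]
          exact Finset.sum_congr rfl fun _ _ => Finset.sum_comm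
      _ = ∑ τ : Equiv.Perm (Fin N), ∑ σ : Equiv.Perm (Fin N),
          (if m ∘ σ = m ∘ τ then (1 : ℂ) else 0) := by
          refine Finset.sum_congr rfl fun τ _ => Finset.sum_congr rfl fun σ _ => ?_
          -- The sum over `f` factorises into inner products of the rows `m (σ i)` and `m (τ i)`,
          -- each 0 or 1.
          have h := Finset.prod_univ_sum (fun _ : Fin N => (Finset.univ : Finset (Fin M)))
            (fun i j => C.1 (m (σ i)) j * starRingEnd ℂ (C.1 (m (τ i)) j))
          rw [Fintype.piFinset_univ] at h
          rw [← h]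
          simp only [hC]
          rw [Finset.prod_ite_zero]
          simp [funext_iff]
      _ = _ := by
          simp only [hcount]
          simp [Fintype.card_perm]
  exact_mod_cast key

/-! ### Averaging one outcome over input permutations -/

theorem card_photonMode_eq {M N : ℕ} (s : Configuration M N) (i : Fin M) :
    Fintype.card {k // photonMode s k = i} = s.1 i := by
  let e : Fin N ≃ (i : Fin M) × Fin (s.1 i) := (finCongr s.2.symm).trans finSigmaFinEquiv.symm
  have h1 : {k // photonMode s k = i} ≃ {x : (i : Fin M) × Fin (s.1 i) // x.1 = i} :=
    e.subtypeEquiv fun k => Iff.rfl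
  rw [Fintype.card_congr (h1.trans (Equiv.sigmaSubtype i)), Fintype.card_fin]

theorem photonMode_injective {M N : ℕ} {t : Configuration M N} (ht : CollisionFree t) :
    Function.Injective (photonMode t) := by
  intro a b hab
  have h : Fintype.card {k // photonMode t k = photonMode t b} ≤ 1 :=
    (card_photonMode_eq t _).trans_le (ht _)
  have := Fintype.card_le_one_iff.mp h ⟨a, hab⟩ ⟨b, rfl⟩
  exact congrArg Subtype.val this

/-- If nonempty, this set is a coset of the pointwise stabilizer of the range of `g`, which is the
symmetric group on the other `M - N` points. -/
theorem card_perm_comp_eq_le {M N : ℕ} {g : Fin N → Fin M} (hg : Function.Injective g)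
    (f : Fin N → Fin M) :
    (Finset.univ.filter fun σ : Equiv.Perm (Fin M) => ⇑σ ∘ g = f).card ≤ (M - N).factorial := by
  classical
  rcases (Finset.univ.filter fun σ : Equiv.Perm (Fin M) => ⇑σ ∘ g = f).eq_empty_or_nonempty with
    h | ⟨σ₀, h₀⟩
  · simp [h]
  have h₀ : ⇑σ₀ ∘ g = f := (Finset.mem_filter.mp h₀).2
  let p : Fin M → Prop := fun x => x ∉ Set.range g
  have hcard : Fintype.card {σ : Equiv.Perm (Fin M) // ∀ a, ¬ p a → σ a = a}
      = (M - N).factorial := by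
    rw [← Fintype.card_congr (Equiv.Perm.subtypeEquivSubtypePerm p), Fintype.card_perm]
    congr 1
    rw [Fintype.card_subtype_compl]
    have : Fintype.card {x // x ∈ Set.range g} = N := by
      rw [← Fintype.card_congr (Equiv.ofInjective g hg), Fintype.card_fin]
    rw [this, Fintype.card_fin]
  rw [← hcard, Fintype.card_subtype]
  refine Finset.card_le_card_of_injOn (fun σ => σ₀⁻¹ * σ) ?_ ?_
  · intro σ hσ
    have hσ : ⇑σ ∘ g = f := by simpa using hσ
    simp only [Finset.coe_filter, Finset.mem_univ, true_and, Set.mem_ofPred_eq]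
    intro a ha
    obtain ⟨k, rfl⟩ := not_not.mp ha
    have := (congrFun hσ k).trans (congrFun h₀ k).symm
    simp only [Function.comp_apply] at this
    simp [this]
  · intro σ _ τ _ h
    exact mul_left_cancel h

/-- The inverse appears because `σ.permMatrix` has its ones at the entries `(k, σ k)`. -/
theorem photonMatrix_mul_permUnitary {M N : ℕ} (C : U M) (σ : Equiv.Perm (Fin M))
    (s t : Configuration M N) :
    photonMatrix (C * permUnitary σ) s t
      = (C : Matrix (Fin M) (Fin M) ℂ).submatrix (photonMode s) (⇑σ⁻¹ ∘ photonMode t) := by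
  ext a b
  simp only [photonMatrix, permUnitary, Matrix.submatrix_apply, Function.comp_apply]
  change ((C : Matrix (Fin M) (Fin M) ℂ) * σ.permMatrix ℂ) _ _ = _
  simp [Matrix.mul_apply, Equiv.Perm.permMatrix, PEquiv.toMatrix_apply, Equiv.toPEquiv_apply,
    ← Equiv.Perm.eq_inv_iff_eq]

/-- A bound on the total output probability of `s` over all permutations that act first. -/
theorem sum_outputProbability_mul_permUnitary_le {M N : ℕ} {t : Configuration M N}
    (ht : CollisionFree t) (C : U M) (s : Configuration M N) :
    ∑ σ : Equiv.Perm (Fin M), outputProbability t (C * permUnitary σ) s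
      ≤ (M - N).factorial * N.factorial := by
  classical
  set F : (Fin N → Fin M) → ℝ := fun f =>
    ‖((C : Matrix (Fin M) (Fin M) ℂ).submatrix (photonMode s) f).permanent‖ ^ 2 with hF
  have hpos : (0 : ℝ) < ∏ i, ((s.1 i).factorial : ℝ) :=
    Finset.prod_pos fun i _ => by exact_mod_cast Nat.factorial_pos _
  have hsum : ∑ f, F f = N.factorial * ∏ i, ((s.1 i).factorial : ℝ) := by
    simp only [hF, sum_norm_sq_permanent_submatrix, card_photonMode_eq]
  have h1 : ∑ σ : Equiv.Perm (Fin M), F (⇑σ⁻¹ ∘ photonMode t)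
      ≤ (M - N).factorial * ∑ f, F f := by
    have hinv := Equiv.sum_comp (Equiv.inv (Equiv.Perm (Fin M))) fun σ => F (⇑σ ∘ photonMode t)
    simp only [Equiv.inv_apply] at hinv
    -- Group the permutations by the column choice `f` they induce; the choices that do not occur
    -- have empty fibres and only enlarge the bound.
    rw [hinv,
      ← Finset.sum_fiberwise Finset.univ (fun σ : Equiv.Perm (Fin M) => ⇑σ ∘ photonMode t),
      Finset.mul_sum]
    refine Finset.sum_le_sum fun f _ => ?_
    rw [Finset.sum_congr rfl (g := fun _ => F f) fun σ hσ => by rw [(Finset.mem_filter.mp hσ).2],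
      Finset.sum_const, nsmul_eq_mul]
    refine mul_le_mul_of_nonneg_right ?_ (sq_nonneg _)
    exact_mod_cast card_perm_comp_eq_le (photonMode_injective ht) f
  simp only [outputProbability, photonMatrix_mul_permUnitary]
  rw [← Finset.mul_sum, one_div, inv_mul_le_iff₀ hpos]
  calc _ ≤ (M - N).factorial * ∑ f, F f := h1
    _ = _ := by rw [hsum]; ring

/-! ### Counting collision configurations -/

theorem card_configuration (M N : ℕ) :
    Fintype.card (Configuration M N) = (M + N - 1).choose N := by
  rw [← Fintype.card_congr (Sym.equivNatSumOfFintype (Fin M) N), Sym.card_sym_eq_choose,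
    Fintype.card_fin]

open Classical in
theorem choose_le_card_collisionFree (M N : ℕ) :
    M.choose N ≤ (Finset.univ.filter fun s : Configuration M N => CollisionFree s).card := by
  have h : ((Finset.univ : Finset (Fin M)).powersetCard N).card = M.choose N := by simp
  rw [← h, ← Finset.card_attach]
  refine Finset.card_le_card_of_injOn
    (fun S => ⟨fun i => if i ∈ S.1 then 1 else 0, by
      simpa using (Finset.mem_powersetCard.mp S.2).2⟩) ?_ ?_
  · intro S _
    simp only [Finset.coe_filter, Finset.mem_univ, true_and, Set.mem_ofPred_eq]
    intro i
    dsimp only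
    split_ifs <;> simp
  · intro S _ T _ hST
    refine Subtype.ext (Finset.ext fun i => ?_)
    have := congrFun (congrArg Subtype.val hST) i
    dsimp only at this
    split_ifs at this <;> simp_all

open Classical in
theorem card_collision_le (M N : ℕ) :
    ((Finset.univ.filter fun s : Configuration M N => s ∈ collisionOutcomes M N).card : ℝ)
      ≤ (M + N - 1).choose N - M.choose N := by
  have h1 := Finset.card_filter_add_card_filter_not
    (s := (Finset.univ : Finset (Configuration M N)))
    (fun s : Configuration M N => CollisionFree s)
  rw [Finset.card_univ, card_configuration M N] at h1
  have h2 := choose_le_card_collisionFree M N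
  have h3 : (Finset.univ.filter fun s : Configuration M N => s ∈ collisionOutcomes M N)
      = Finset.univ.filter fun s : Configuration M N => ¬ CollisionFree s :=
    Finset.filter_congr fun _ _ => Iff.rfl
  rw [h3, le_sub_iff_add_le]
  exact_mod_cast (by omega :
    (Finset.univ.filter fun s : Configuration M N => ¬ CollisionFree s).card + M.choose N
      ≤ (M + N - 1).choose N)

/-- The ratio of the numbers of all and of the collision-free configurations is near `1`. -/
theorem choose_multiset_lt {M N : ℕ} (hN : 1 ≤ N) (hM : 2 * N ^ 2 ≤ M) :
    ((M + N - 1).choose N : ℝ) < (1 + 2 * (N : ℝ) ^ 2 / M) * M.choose N := by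
  have hNM : N ≤ M := by nlinarith
  have hNr : (1 : ℝ) ≤ N := by exact_mod_cast hN
  have hMr : 2 * (N : ℝ) ^ 2 ≤ M := by exact_mod_cast hM
  have hM0 : (0 : ℝ) < M := by nlinarith
  set y : ℝ := (N : ℝ) ^ 2 / M with hy
  have hy0 : 0 < y := by positivity
  have hy1 : y ≤ 1 / 2 := by rw [hy, div_le_iff₀ hM0]; linarith
  have hD : (0 : ℝ) < M - N + 1 := by nlinarith
  -- Factor by factor, `(M + i) / (M - i) = 1 + 2i / (M - i) ≤ exp (2i / (M - N + 1))`. The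
  -- exponents add up to `N(N - 1) / (M - N + 1)`, which is at most `y` because `N² - N ≤ M`.
  have hasc : ((M.ascFactorial N : ℕ) : ℝ) ≤ Real.exp y * (M.descFactorial N : ℕ) := by
    rw [Nat.ascFactorial_eq_prod_range, Nat.descFactorial_eq_prod_range]
    push_cast
    calc ∏ i ∈ Finset.range N, ((M : ℝ) + i)
        ≤ ∏ i ∈ Finset.range N, (Real.exp (i * (2 / (M - N + 1))) * ((M - i : ℕ) : ℝ)) := by
          refine Finset.prod_le_prod (fun i _ => by positivity) fun i hi => ?_
          have hi' : i + 1 ≤ N := Finset.mem_range.mp hi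
          have hir : (i : ℝ) + 1 ≤ N := by exact_mod_cast hi'
          rw [Nat.cast_sub (by omega)]
          have hMi : (0 : ℝ) < M - i := by linarith
          have h1 : (i : ℝ) * (2 / (M - i)) ≤ i * (2 / (M - N + 1)) := by
            gcongr
            linarith
          have h2 := (Real.add_one_le_exp _).trans (Real.exp_le_exp.mpr h1)
          refine le_trans (le_of_eq ?_) (mul_le_mul_of_nonneg_right h2 hMi.le)
          field_simp
          ring
      _ = Real.exp (∑ i ∈ Finset.range N, i * (2 / ((M : ℝ) - N + 1)))
            * ∏ i ∈ Finset.range N, ((M - i : ℕ) : ℝ) := by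
          rw [Finset.prod_mul_distrib, Real.exp_sum]
      _ ≤ _ := by
          refine mul_le_mul_of_nonneg_right (Real.exp_le_exp.mpr ?_)
            (Finset.prod_nonneg fun _ _ => Nat.cast_nonneg _)
          have hg : (∑ i ∈ Finset.range N, (i : ℝ)) * 2 = N * (N - 1) := by
            have := Finset.sum_range_id_mul_two N
            have h := congrArg (Nat.cast : ℕ → ℝ) this
            push_cast [Nat.cast_sub hN] at h
            exact h
          rw [← Finset.sum_mul, mul_div_assoc', hg, hy, div_le_div_iff₀ hD hM0]
          nlinarith
  -- From `exp y ≤ 1 + y + y²` and `y² < y`; strictness uses `0 < y`.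
  have hexp : Real.exp y < 1 + 2 * y := by
    have := Real.abs_exp_sub_one_sub_id_le (x := y) (by rw [abs_le]; constructor <;> linarith)
    have := (abs_le.mp this).2
    nlinarith
  rw [Nat.ascFactorial_eq_factorial_mul_choose', Nat.descFactorial_eq_factorial_mul_choose] at hasc
  push_cast at hasc
  have hf : (0 : ℝ) < N.factorial := by exact_mod_cast Nat.factorial_pos N
  have hc : (0 : ℝ) < M.choose N := by exact_mod_cast Nat.choose_pos hNM
  have h3 : ((M + N - 1).choose N : ℝ) ≤ Real.exp y * M.choose N := by
    refine le_of_mul_le_mul_left ?_ hf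
    linarith
  refine h3.trans_lt ?_
  rw [mul_div_assoc]
  exact mul_lt_mul_of_pos_right hexp hc

/-- The average over permutations of the collision probability of a fixed circuit. -/
theorem average_collision_le {M N : ℕ} (hN : 1 ≤ N) (hM : 2 * N ^ 2 ≤ M)
    {t : Configuration M N} (ht : CollisionFree t) (C : U M) :
    ∑ σ : Equiv.Perm (Fin M), ((M.factorial : ℝ))⁻¹ *
        outcomeProbability t (C * permUnitary σ) (collisionOutcomes M N)
      ≤ ((M + N - 1).choose N - M.choose N) / M.choose N := by
  classical
  have hNM : N ≤ M := by nlinarith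
  have hc : (0 : ℝ) < M.choose N := by exact_mod_cast Nat.choose_pos hNM
  have hf : (0 : ℝ) < M.factorial := by exact_mod_cast Nat.factorial_pos M
  have hfac : (M.choose N : ℝ) * ((M - N).factorial * N.factorial) = M.factorial := by
    rw [← Nat.choose_mul_factorial_mul_factorial hNM]
    push_cast
    ring
  rw [← Finset.mul_sum, inv_mul_le_iff₀ hf]
  simp only [outcomeProbability]
  rw [Finset.sum_comm]
  calc _ ≤ ∑ s : Configuration M N with s ∈ collisionOutcomes M N,
        (((M - N).factorial : ℝ) * N.factorial) :=
        Finset.sum_le_sum fun s _ => sum_outputProbability_mul_permUnitary_le ht C s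
    _ ≤ ((M + N - 1).choose N - M.choose N) * ((M - N).factorial * N.factorial) := by
        rw [Finset.sum_const, nsmul_eq_mul]
        refine mul_le_mul_of_nonneg_right ?_ (by positivity)
        exact card_collision_le M N
    _ = _ := by
        rw [← hfac]
        field_simp

/-! ### Integration against the ensembles -/

theorem continuous_outcomeProbability {M N : ℕ} (t : Configuration M N)
    (S : Set (Configuration M N)) : Continuous fun C : U M => outcomeProbability t C S := by
  unfold outcomeProbability outputProbability Matrix.permanent photonMatrix
  refine continuous_finsetSum _ fun s _ => continuous_const.mul (Continuous.pow ?_ 2)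
  refine Continuous.norm (continuous_finsetSum _ fun σ _ => continuous_finsetProd _ fun i _ => ?_)
  exact continuous_subtype_val.matrix_elem _ _

theorem integrable_of_continuous {M : ℕ} {f : U M → ℝ} (hf : Continuous f)
    (μ : Measure (U M)) [IsFiniteMeasure μ] : Integrable f μ :=
  hf.integrable_of_hasCompactSupport (HasCompactSupport.of_compactSpace f)

theorem integral_permutationEnsemble {M : ℕ} {f : U M → ℝ} (hf : Continuous f) :
    ∫ P, f P ∂(permutationEnsemble M)
      = ∑ σ : Equiv.Perm (Fin M), ((M.factorial : ℝ))⁻¹ * f (permUnitary σ) := by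
  -- The discrete σ-algebra makes `permUnitary` measurable, so the integral pulls back to a finite
  -- sum.
  let _ : MeasurableSpace (Equiv.Perm (Fin M)) := ⊤
  have hm : Measurable (permUnitary (M := M)) := measurable_from_top
  have h : permutationEnsemble M
      = (PMF.uniformOfFintype (Equiv.Perm (Fin M))).toMeasure.map permUnitary := by
    ext S hS
    rw [Measure.map_apply hm hS, permutationEnsemble, PMF.toMeasure_map_apply _ _ _ hm hS]
  rw [h, integral_map hm.aemeasurable hf.aestronglyMeasurable, PMF.integral_eq_sum]
  simp [Fintype.card_perm]

end BosonSampling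

theorem mainTheorem7 (M N : ℕ) (hN : 1 ≤ N) (hM : 2 * N ^ 2 ≤ M)
    (A : BosonSampling.Architecture M)
    (t : BosonSampling.Configuration M N) (ht : BosonSampling.CollisionFree t) :
    MeasureTheory.Integrable
        (fun C : BosonSampling.U M =>
          BosonSampling.outcomeProbability t C (BosonSampling.collisionOutcomes M N))
        (BosonSampling.productEnsemble A) ∧
      (∫ C : BosonSampling.U M,
          BosonSampling.outcomeProbability t C (BosonSampling.collisionOutcomes M N)
          ∂(BosonSampling.productEnsemble A)) < 2 * (N : ℝ) ^ 2 / (M : ℝ) := by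
  have hcont := BosonSampling.continuous_outcomeProbability t (BosonSampling.collisionOutcomes M N)
  have hmul : Continuous fun x : BosonSampling.U M × BosonSampling.U M => x.1 * x.2 :=
    continuous_fst.mul continuous_snd
  have hint := BosonSampling.integrable_of_continuous hcont (BosonSampling.productEnsemble A)
  refine ⟨hint, ?_⟩
  have hint' : MeasureTheory.Integrable
      (fun x : BosonSampling.U M × BosonSampling.U M =>
        BosonSampling.outcomeProbability t (x.1 * x.2) (BosonSampling.collisionOutcomes M N))
      ((BosonSampling.localRandomEnsemble A).prod (BosonSampling.permutationEnsemble M)) :=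
    hint.comp_measurable hmul.measurable
  have hc : (0 : ℝ) < M.choose N := by exact_mod_cast Nat.choose_pos (by nlinarith : N ≤ M)
  have hbound : (((M + N - 1).choose N : ℝ) - M.choose N) / M.choose N < 2 * (N : ℝ) ^ 2 / M := by
    rw [div_lt_iff₀ hc]
    linarith [BosonSampling.choose_multiset_lt hN hM]
  refine lt_of_le_of_lt ?_ hbound
  rw [BosonSampling.productEnsemble, MeasureTheory.integral_map hmul.measurable.aemeasurable
    hcont.aestronglyMeasurable, MeasureTheory.integral_prod _ hint']
  -- The inner integral over permutations is bounded by a constant independent of `H`, and the law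
  -- of `H` has total mass 1.
  calc _ ≤ ∫ _ : BosonSampling.U M, (((M + N - 1).choose N : ℝ) - M.choose N) / M.choose N
        ∂(BosonSampling.localRandomEnsemble A) := by
        refine MeasureTheory.integral_mono hint'.integral_prod_left
          (MeasureTheory.integrable_const _) fun H => ?_
        dsimp only
        exact (BosonSampling.integral_permutationEnsemble
          (hcont.comp (continuous_const_mul H))).trans_le
            (BosonSampling.average_collision_le hN hM ht H)
    _ = _ := by simp
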